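/- **Setting.** Let $d\ge 0$, $H=\ell^2(\mathbb Z^d)$ (real sequences), and let $(i,H,B)$ be an abstract Wiener space: $B$ is a Banach space and $i:H\to B$ is a continuous linear injection with dense range such that, for all $\varepsilon,h>0$, there is a finite-dimensional subspace $F\subset H$ for which every finite-dimensional subspace $E\perp F$ of $H$ satisfies $\mu_{E,h}(\{y\in E:\ \|i(y)\|_B>\varepsilon\})<\varepsilon$, where $d\mu_{E,h}(y)=(2\pi h)^{-\dim E/2}e^{-|y|^2/(2h)}\,dy$. Identify $u\in B'$ with the vector of $H$ representing $u\circ i$, so that $B'\subset H$ densely. For $h>0$, let $\mu_{B,h}$ be the Borel probability measure on $B$ under which any $u_1,\dots,u_n\in B'$ that are orthonormal in $H$ are independent with law $N(0,h)$. Let $a\mapsto\ell_a$, $H\to L^2(B,\mu_{B,h})$, be the continuous extension of the inclusion $B'\subset L^2(B,\mu_{B,h})$. For a finite-dimensional subspace $E\subset H$ with orthonormal basis $(u_j)$ put $\widetilde\pi_E(x)=\sum_j\ell_{u_j}(x)\,u_j$ for almost every $x\in B$. A Borel function $f$ on $H$ *admits the stochastic extension* $\widetilde f$, a Borel function on $B$,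 with respect to $\mu_{B,h}$ if, for every increasing sequence $(E_n)$ of finite-dimensional subspaces of $H$ with dense union, $f\circ\widetilde\pi_{E_n}\to\widetilde f$ in $\mu_{B,h}$-probability. It admits the stochastic extension $\widetilde f\in L^1(B,\mu_{B,h})$ *in the sense of $L^1$* if, for every such sequence, $f\circ\widetilde\pi_{E_n}\in L^1(B,\mu_{B,h})$ for all $n$ and $f\circ\widetilde\pi_{E_n}\to\widetilde f$ in $L^1(B,\mu_{B,h})$. **Proposition 8.8.** Let $|\cdot|$ be an $\ell^q$ norm on $\mathbb R^d$, $1\le q\le\infty$. Let $V:\mathbb R\to[0,\infty)$ be Lipschitz, and let $(g_j)_{j\in\mathbb Z^d}$ be a square summable family of positive real numbers for which there is a constant $C$ with $g_j/g_k\le C$ whenever $|j-k|\le 1$. For $x\in H$ and $t>0$ put $$p(x)=\sum_{\substack{(j,k)\in\mathbb Z^d\times\mathbb Z^d\\ |j-k|=1}}g_jg_k\,V(x_j-x_k),\qquad A_t(x)=e^{-t\,p(x)}.$$ Then the series defining $p(x)$ converges for every $x\in H$ and, for every $h>0$, the measure $\mu_{B,h}$ exists; with respect to it, $A_t$ admits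 a stochastic extension $\widetilde A_t$ for every $t>0$, and $p$ admits a stochastic extension in the sense of $L^1(B,\mu_{B,h})$. In particular, for every increasing sequence $(E_n)$ of finite-dimensional subspaces of $H$ with dense union, $(p\circ\widetilde\pi_{E_n})$ is a Cauchy sequence in $L^1(B,\mu_{B,h})$. -/

import Mathlib

open MeasureTheory ProbabilityTheory Filter Topology
open scoped ENNReal NNReal RealInnerProductSpace

noncomputable section

namespace Wiener

section Gaussian

variable (E : Type*) [NormedAddCommGroup E] [InnerProductSpace ℝ E] [FiniteDimensional ℝ E]
  [MeasurableSpace E]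

/-- The centred Gaussian measure on a finite-dimensional Euclidean space `E` with variance `h`,
that is, with density `(2πh)^(-dim E / 2) exp(-|x|² / (2h))` with respect to the Lebesgue measure
when `h > 0`: the image of the standard Gaussian measure under `y ↦ √h y`. -/
def gaussian (h : ℝ≥0) : Measure E :=
  (stdGaussian E).map (fun y => Real.sqrt h • y)

end Gaussian

section AbstractWiener

variable {H : Type*} [NormedAddCommGroup H] [InnerProductSpace ℝ H] [MeasurableSpace H]
  {B : Type*} [NormedAddCommGroup B] [NormedSpace ℝ B]

/-- Gross' definition: `(i, H, B)` is an abstract Wiener space when `H` is separable, `i` is a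
continuous injection with dense range, and the norm of `B` is measurable: for all `ε, h > 0` there
is a finite-dimensional subspace `F` of `H` such that, for every finite-dimensional `E` orthogonal
to `F`, the cylinder measure of `{x ∈ H | ‖i (π_E x)‖ > ε}`, i.e. the Gaussian measure of
`{y ∈ E | ‖i y‖ > ε}`, is less than `ε`. Completeness of `H` and `B` is required separately. -/
structure IsAbstractWienerSpace (i : H →L[ℝ] B) : Prop where
  separable : TopologicalSpace.SeparableSpace H
  injective : Function.Injective i
  denseRange : DenseRange i
  measurable_norm : ∀ (ε : ℝ) (h : ℝ≥0), 0 < ε → 0 < h →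
    ∃ F : Submodule ℝ H, FiniteDimensional ℝ F ∧
      ∀ (E : Submodule ℝ H) [FiniteDimensional ℝ E], E ⟂ F →
        gaussian E h {y : E | ε < ‖i (y : H)‖} < ENNReal.ofReal ε

end AbstractWiener

section Measure

variable {H : Type*} [NormedAddCommGroup H] [InnerProductSpace ℝ H] [CompleteSpace H]
  {B : Type*} [NormedAddCommGroup B] [NormedSpace ℝ B]

/-- The embedding `B' → H' = H`: the vector `riesz i u` of `H` is the one with
`⟪riesz i u, x⟫ = u (i x)` for all `x` in `H`. -/
def riesz (i : H →L[ℝ] B) : StrongDual ℝ B →ₗ[ℝ] H where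
  toFun u := (InnerProductSpace.toDual ℝ H).symm (u.comp i)
  map_add' u v := by simp
  map_smul' c u := by simp

theorem inner_riesz (i : H →L[ℝ] B) (u : StrongDual ℝ B) (x : H) :
    ⟪riesz i u, x⟫ = u (i x) := by
  simp [riesz]

variable [MeasurableSpace B]

/-- `μ` is the Gaussian measure `μ_{B,h}` of the abstract Wiener space: the Borel probability
measure on `B` that extends the cylinder measure, i.e. for all `u₁, …, uₙ` in `B'` that are
orthonormal for the scalar product of `H`, the random variables `u₁, …, uₙ` are independent with
law `N(0, h)`. -/
structure IsWienerMeasure (i : H →L[ℝ] B) (h : ℝ≥0) (μ : Measure B) : Prop where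
  isProbabilityMeasure : IsProbabilityMeasure μ
  map_eq : ∀ (n : ℕ) (u : Fin n → StrongDual ℝ B), Orthonormal ℝ (fun k => riesz i (u k)) →
    μ.map (fun x k => u k x) = Measure.pi (fun _ : Fin n => gaussianReal 0 h)

variable [BorelSpace B]

/-- The map `a ↦ ℓ_a` from `H` to `L²(B, μ)`: the continuous extension, along the dense embedding
`riesz i : B' → H`, of the inclusion of `B'` into `L²(B, μ)`. -/
def ell (i : H →L[ℝ] B) (μ : Measure B) : H →L[ℝ] Lp ℝ 2 μ :=
  (StrongDual.toLp μ 2 : StrongDual ℝ B →L[ℝ] Lp ℝ 2 μ).toLinearMap.extendOfNorm (riesz i)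

/-- The (almost everywhere defined) extension to `B` of the orthogonal projection of `H` onto the
finite-dimensional subspace `E`: `x ↦ ∑ⱼ ℓ_{uⱼ}(x) uⱼ`, for an orthonormal basis `(uⱼ)` of `E`. -/
def proj (i : H →L[ℝ] B) (μ : Measure B) (E : Submodule ℝ H) [FiniteDimensional ℝ E] (x : B) : H :=
  ∑ j, (ell i μ (stdOrthonormalBasis ℝ E j : H) : B → ℝ) x • (stdOrthonormalBasis ℝ E j : H)

variable [MeasurableSpace H]
  {G : Type*} [NormedAddCommGroup G] [MeasurableSpace G]

/-- The Borel function `f` on `H` admits `f'` as a stochastic extension with respect to `μ`: for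
every increasing sequence `(Eₙ)` of finite-dimensional subspaces of `H` whose union is dense, the
functions `f ∘ π̃_{Eₙ}` converge to `f'` in `μ`-probability. -/
structure IsStochasticExtension (i : H →L[ℝ] B) (μ : Measure B) (f : H → G) (f' : B → G) :
    Prop where
  measurable : Measurable f
  measurable_ext : Measurable f'
  tendsto : ∀ (E : ℕ → Submodule ℝ H) [∀ n, FiniteDimensional ℝ (E n)], Monotone E →
    Dense (⋃ n, (E n : Set H)) →
      TendstoInMeasure μ (fun n => f ∘ proj i μ (E n)) atTop f'

/-- The Borel function `f` on `H` admits `f'` as a stochastic extension in the sense of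
`L^p(B, μ)`: for every increasing sequence `(Eₙ)` of finite-dimensional subspaces of `H` whose
union is dense, the functions `f ∘ π̃_{Eₙ}` are in `L^p` and converge to `f'` in `L^p`. -/
structure IsLpStochasticExtension (p : ℝ≥0∞) (i : H →L[ℝ] B) (μ : Measure B) (f : H → G)
    (f' : B → G) : Prop where
  measurable : Measurable f
  memLp_ext : MemLp f' p μ
  tendsto : ∀ (E : ℕ → Submodule ℝ H) [∀ n, FiniteDimensional ℝ (E n)], Monotone E →
    Dense (⋃ n, (E n : Set H)) →
      (∀ n, MemLp (f ∘ proj i μ (E n)) p μ) ∧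
        Tendsto (fun n => eLpNorm (f ∘ proj i μ (E n) - f') p μ) atTop (𝓝 0)

end Measure

section Lattice

/-- The Hilbert space `ℓ²(ℤ^d)` of real sequences. -/
abbrev LatticeL2 (d : ℕ) : Type := lp (fun _ : Fin d → ℤ => ℝ) 2

/-- The `ℓ^q` norm of the point `m` of `ℤ^d ⊆ ℝ^d`. -/
def latticeNorm {d : ℕ} (q : ℝ≥0∞) (m : Fin d → ℤ) : ℝ :=
  ‖WithLp.toLp q (fun k => (m k : ℝ))‖

/-- The ordered pairs `(j, k)` of points of `ℤ^d` with `|j - k| = 1` for the `ℓ^q` norm. -/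
abbrev Neighbours (d : ℕ) (q : ℝ≥0∞) : Type :=
  {jk : (Fin d → ℤ) × (Fin d → ℤ) // latticeNorm q (jk.1 - jk.2) = 1}

/-- The term `g_j g_k V(x_j - x_k)` of the interaction. -/
def interactionTerm {d : ℕ} (q : ℝ≥0∞) (g : (Fin d → ℤ) → ℝ) (V : ℝ → ℝ) (x : LatticeL2 d)
    (jk : Neighbours d q) : ℝ :=
  g jk.1.1 * g jk.1.2 * V (x jk.1.1 - x jk.1.2)

/-- `p(x) = ∑_{|j - k| = 1} g_j g_k V(x_j - x_k)`. -/
def interaction {d : ℕ} (q : ℝ≥0∞) (g : (Fin d → ℤ) → ℝ) (V : ℝ → ℝ) (x : LatticeL2 d) : ℝ :=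
  ∑' jk : Neighbours d q, interactionTerm q g V x jk

end Lattice

end Wiener

end

/-! Extension of the interaction. The `j`-th coordinate of the projected random vector is its
pairing with the unit vector `e_j`, hence almost everywhere `ℓ(π_E e_j)` (`inner_fieldProj`). Since
`‖ℓ_a‖₂ ≤ √h ‖a‖` (`norm_ell_le`), these variables are bounded by `√h` in `L²`, uniformly in `j` and
`E`, and along `(E_n)` they converge in `L²` to `ℓ(e_j)` because `π_{E_n} e_j → e_j`. As `V` is
`K`-Lipschitz, the `L¹` distance between two energies is at most `K` times the sum, over
neighbouring pairs, of `g_j g_k` times the `L²` distances of the two coordinates involved. The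
weights are summable: a site has finitely many neighbours and `2 g_j g_k ≤ g_j² + g_k²`. Dominated
convergence over the pairs gives `L¹` convergence to the energy of the field `(ℓ(e_j))_j`. Since
`exp(-t ·)` is `t`-Lipschitz on `[0, ∞)`, convergence passes to `A_t`.

Existence of the measure (Gross). From an isonormal process `W` on `H`, built from i.i.d. normal
variables over a Hilbert basis, form the finite-dimensional vectors `√h W_{G_n}`. Measurability of
the norm lets `G_n` be chosen so that the increments of their images in `B` exceed `2⁻ⁿ` with
probability at most `2⁻ⁿ`. By Borel–Cantelli the images converge almost surely in `B`, and the law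
of the limit is the required measure. -/

noncomputable section

namespace Wiener

/-! ### Isonormal Gaussian processes on a Hilbert space -/

section Isonormal

variable {Ω : Type*} [MeasurableSpace Ω] {P : Measure Ω}
  {H : Type*} [NormedAddCommGroup H] [InnerProductSpace ℝ H]

/-- `W` is an isonormal process: every `W a` is a centred Gaussian variable of variance `‖a‖²`. -/
def IsIsonormal (W : H →L[ℝ] Lp ℝ 2 P) : Prop :=
  ∀ a, ∫ ω, Complex.exp (((W a : Ω → ℝ) ω : ℂ) * Complex.I) ∂P = Complex.exp (-(‖a‖ : ℂ) ^ 2 / 2)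

theorem coeFn_sum_smul {n : ℕ} (L : H →L[ℝ] Lp ℝ 2 P) (c : Fin n → ℝ) (u : Fin n → H) :
    (L (∑ k, c k • u k) : Ω → ℝ) =ᵐ[P] fun ω => ∑ k, c k * (L (u k) : Ω → ℝ) ω := by
  have h1 : ∀ᵐ ω ∂P, ∀ k, (c k • L (u k) : Lp ℝ 2 P) ω = c k * (L (u k) : Ω → ℝ) ω := by
    rw [ae_all_iff]
    intro k
    filter_upwards [Lp.coeFn_smul (c k) (L (u k))] with ω hω
    simpa using hω
  rw [map_sum]
  filter_upwards [h1, Lp.coeFn_finsetSum (p := 2) (μ := P) Finset.univ (fun k => L (c k • u k))]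
    with ω h1 h2
  rw [h2]
  simp only [Finset.sum_apply, map_smul]
  exact Finset.sum_congr rfl fun k _ => h1 k

theorem norm_sum_sq_of_orthonormal {n : ℕ} {u : Fin n → H} (hu : Orthonormal ℝ u) (c : Fin n → ℝ) :
    ‖∑ k, c k • u k‖ ^ 2 = ∑ k, c k ^ 2 := by
  rw [← real_inner_self_eq_norm_sq, hu.inner_sum]
  simp [sq]

/-- The joint characteristic function at `t` is the one-dimensional one of `W (∑ t_k u_k)`, and `‖∑
t_k u_k‖² = ∑ t_k²`, so it factorises. -/
theorem IsIsonormal.map_eq_pi [IsProbabilityMeasure P] {W : H →L[ℝ] Lp ℝ 2 P}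
    (hW : IsIsonormal W) {n : ℕ} {u : Fin n → H} (hu : Orthonormal ℝ u) :
    P.map (fun ω k => (W (u k) : Ω → ℝ) ω) = Measure.pi (fun _ : Fin n => gaussianReal 0 1) := by
  have hm : Measurable (fun ω k => (W (u k) : Ω → ℝ) ω) :=
    measurable_pi_lambda _ fun k => (Lp.stronglyMeasurable (W (u k))).measurable
  have : IsProbabilityMeasure (P.map (fun ω k => (W (u k) : Ω → ℝ) ω)) :=
    Measure.isProbabilityMeasure_map hm.aemeasurable
  rw [← charFun_eq_pi_iff]
  intro t
  rw [Measure.map_map (by fun_prop) hm, charFun_apply, integral_map (by fun_prop) (by fun_prop)]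
  have h1 := hW (∑ k, t.ofLp k • u k)
  have h2 : ∀ᵐ ω ∂P, Complex.exp ((inner ℝ ((WithLp.toLp 2 ∘ fun ω k => (W (u k) : Ω → ℝ) ω) ω) t
      : ℂ) * Complex.I) =
      Complex.exp (((W (∑ k, t.ofLp k • u k) : Ω → ℝ) ω : ℂ) * Complex.I) := by
    filter_upwards [coeFn_sum_smul W t.ofLp u] with ω hω
    rw [hω, PiLp.inner_apply]
    simp [mul_comm]
  rw [integral_congr_ae h2, h1]
  simp only [charFun_gaussianReal, ← Complex.exp_sum]
  congr 1
  have := norm_sum_sq_of_orthonormal hu t.ofLp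
  rw [← Complex.ofReal_pow, this]
  simp [Finset.sum_div, neg_div]

/-- From `|e^{ix} - e^{iy}| ≤ |x - y|` and `L¹ ≤ L²` on a probability space. It reduces the
isonormal identity to a dense subspace. -/
theorem continuous_integral_exp_mul_I [IsProbabilityMeasure P] (W : H →L[ℝ] Lp ℝ 2 P) :
    Continuous fun a => ∫ ω, Complex.exp (((W a : Ω → ℝ) ω : ℂ) * Complex.I) ∂P := by
  have key : ∀ f g : Lp ℝ 2 P, ‖(∫ ω, Complex.exp (((f : Ω → ℝ) ω : ℂ) * Complex.I) ∂P) -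
      ∫ ω, Complex.exp (((g : Ω → ℝ) ω : ℂ) * Complex.I) ∂P‖ ≤ ‖f - g‖ := by
    intro f g
    have hint : ∀ f : Lp ℝ 2 P,
        Integrable (fun ω => Complex.exp (((f : Ω → ℝ) ω : ℂ) * Complex.I)) P := by
      intro f
      refine Integrable.of_bound (C := 1) ?_ (by simp [Complex.norm_exp_ofReal_mul_I])
      have := (Lp.stronglyMeasurable f).measurable
      exact Measurable.aestronglyMeasurable (by fun_prop)
    rw [← integral_sub (hint f) (hint g)]
    have hL1 : Integrable (fun ω => ‖(f - g : Lp ℝ 2 P) ω‖) P :=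
      ((Lp.memLp (f - g)).integrable (by norm_num)).norm
    calc _ ≤ ∫ ω, ‖(f - g : Lp ℝ 2 P) ω‖ ∂P := by
          refine norm_integral_le_of_norm_le hL1 ?_
          filter_upwards [Lp.coeFn_sub f g] with ω hω
          rw [hω]
          have : Complex.exp (((f : Ω → ℝ) ω : ℂ) * Complex.I) -
              Complex.exp (((g : Ω → ℝ) ω : ℂ) * Complex.I) =
              Complex.exp (((g : Ω → ℝ) ω : ℂ) * Complex.I) *
                (Complex.exp (Complex.I * ((f ω - g ω : ℝ) : ℂ)) - 1) := by
            rw [mul_sub, ← Complex.exp_add]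
            congr 2
            · push_cast; ring
            · ring
          rw [this, norm_mul, Complex.norm_exp_ofReal_mul_I, one_mul]
          exact Real.norm_exp_I_mul_ofReal_sub_one_le
      _ = (eLpNorm (f - g : Lp ℝ 2 P) 1 P).toReal := by
          rw [eLpNorm_one_eq_lintegral_enorm, integral_norm_eq_lintegral_enorm
            (Lp.aestronglyMeasurable _)]
      _ ≤ (eLpNorm (f - g : Lp ℝ 2 P) 2 P).toReal :=
          ENNReal.toReal_mono (Lp.eLpNorm_ne_top _)
            (eLpNorm_le_eLpNorm_of_exponent_le (by norm_num) (Lp.aestronglyMeasurable _))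
      _ = ‖f - g‖ := (Lp.norm_def _).symm
  have h2 : LipschitzWith 1 fun f : Lp ℝ 2 P =>
      ∫ ω, Complex.exp (((f : Ω → ℝ) ω : ℂ) * Complex.I) ∂P :=
    LipschitzWith.mk_one fun f g => by rw [dist_eq_norm, dist_eq_norm]; exact key f g
  exact h2.continuous.comp W.continuous

theorem charFun_infinitePi_gaussian {ι : Type*} (s : Finset ι) (c : ι → ℝ) :
    ∫ ω, Complex.exp (((∑ j ∈ s, c j * ω j : ℝ) : ℂ) * Complex.I)
      ∂(Measure.infinitePi fun _ : ι => gaussianReal 0 1) =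
    Complex.exp (-((∑ j ∈ s, c j ^ 2 : ℝ) : ℂ) / 2) := by
  set Q := Measure.infinitePi fun _ : ι => gaussianReal 0 1
  have hmeas : ∀ j, Measurable fun ω : ι → ℝ => c j * ω j := fun j =>
    measurable_const.mul (measurable_pi_apply j)
  have hind : iIndepFun (fun j (ω : ι → ℝ) => c j * ω j) Q :=
    iIndepFun_infinitePi (X := fun j x => c j * x) (fun j => by fun_prop)
  have h := (hind.restrict s).charFun_map_fun_finsetSum_eq_prod (s := s)
    (X := fun j (ω : ι → ℝ) => c j * ω j)
    (fun j _ => (hmeas j).aemeasurable)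
  have h1 := congrFun h 1
  rw [charFun_apply, integral_map (Finset.measurable_fun_sum s fun j _ => hmeas j).aemeasurable
    (by fun_prop)] at h1
  have hlaw : ∀ j, Q.map (fun ω : ι → ℝ => c j * ω j) =
      gaussianReal 0 (NNReal.mk (c j ^ 2) (sq_nonneg _)) := by
    intro j
    have : (fun ω : ι → ℝ => c j * ω j) = (fun x => c j * x) ∘ fun ω => ω j := rfl
    rw [this, ← Measure.map_map (by fun_prop) (by fun_prop), Measure.infinitePi_map_eval,
      gaussianReal_map_const_mul]
    simp
  simp only [Finset.prod_apply, hlaw, charFun_gaussianReal, ← Complex.exp_sum] at h1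
  simpa [Finset.sum_div, neg_div] using h1

theorem memLp_eval_infinitePi_gaussian {ι : Type*} (j : ι) :
    MemLp (fun ω : ι → ℝ => ω j) 2 (Measure.infinitePi fun _ : ι => gaussianReal 0 1) := by
  have h : MemLp (id : ℝ → ℝ) 2
      ((Measure.infinitePi fun _ : ι => gaussianReal 0 1).map (fun ω => ω j)) := by
    rw [Measure.infinitePi_map_eval]
    exact memLp_id_gaussianReal 2
  exact (memLp_map_measure_iff aestronglyMeasurable_id (measurable_pi_apply j).aemeasurable).1 h

theorem orthonormal_eval_infinitePi_gaussian (ι : Type*) :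
    Orthonormal ℝ fun j : ι => (memLp_eval_infinitePi_gaussian j).toLp := by
  classical
  set Q := Measure.infinitePi fun _ : ι => gaussianReal 0 1
  rw [orthonormal_iff_ite]
  intro j k
  have h1 : ⟪(memLp_eval_infinitePi_gaussian j).toLp, (memLp_eval_infinitePi_gaussian k).toLp⟫ =
      ∫ ω : ι → ℝ, ω j * ω k ∂Q := by
    rw [L2.inner_def]
    refine integral_congr_ae ?_
    filter_upwards [(memLp_eval_infinitePi_gaussian j).coeFn_toLp,
      (memLp_eval_infinitePi_gaussian k).coeFn_toLp] with ω hj hk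
    rw [hj, hk]
    simp [mul_comm]
  rw [h1]
  have hmap : ∀ (j : ι) (f : ℝ → ℝ), AEStronglyMeasurable f (gaussianReal 0 1) →
      ∫ ω : ι → ℝ, f (ω j) ∂Q = ∫ x, f x ∂gaussianReal 0 1 := by
    intro j f hf
    rw [← Measure.infinitePi_map_eval (fun _ : ι => gaussianReal 0 1) j] at hf
    rw [← Measure.infinitePi_map_eval (fun _ : ι => gaussianReal 0 1) j,
      integral_map (measurable_pi_apply j).aemeasurable hf]
  split_ifs with hjk
  · subst hjk
    rw [hmap j (fun x => x * x) (by fun_prop)]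
    have := variance_fun_id_gaussianReal (μ := 0) (v := 1)
    rw [variance_eq_integral (by fun_prop)] at this
    simpa [sq] using this
  · have hind : iIndepFun (fun j (ω : ι → ℝ) => ω j) Q :=
      iIndepFun_infinitePi (X := fun _ x => x) (fun j => by fun_prop)
    have := (hind.indepFun hjk).integral_fun_mul_eq_mul_integral
      (measurable_pi_apply j).aestronglyMeasurable (measurable_pi_apply k).aestronglyMeasurable
    rw [this, hmap j (fun x => x) (by fun_prop)]
    simp

theorem exists_isIsonormal (H : Type*) [NormedAddCommGroup H] [InnerProductSpace ℝ H]
    [CompleteSpace H] :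
    ∃ (ι : Set H) (W : H →L[ℝ] Lp ℝ 2 (Measure.infinitePi fun _ : ι => gaussianReal 0 1)),
      IsIsonormal W := by
  classical
  obtain ⟨ι, b, -⟩ := exists_hilbertBasis ℝ H
  set Q := Measure.infinitePi fun _ : ι => gaussianReal 0 1
  -- The coordinates `ξ` are orthonormal in `L²`, so sending the Hilbert basis to them defines an
  -- isometry; on finite combinations the law is explicit.
  set ξ : ι → Lp ℝ 2 Q := fun j => (memLp_eval_infinitePi_gaussian j).toLp
  obtain ⟨U, hU⟩ : ∃ U : lp (fun _ : ι => ℝ) 2 →ₗᵢ[ℝ] Lp ℝ 2 Q, ∀ j, U (lp.single 2 j 1) = ξ j :=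
    ⟨(orthonormal_eval_infinitePi_gaussian ι).orthogonalFamily.linearIsometry, fun j => by
      refine (OrthogonalFamily.linearIsometry_apply_single _ _).trans ?_
      simp [ξ]⟩
  set W : H →ₗᵢ[ℝ] Lp ℝ 2 Q := U.comp b.repr.toLinearIsometry with hWdef
  have hWb : ∀ j, W (b j) = ξ j := by
    intro j
    have : b.repr (b j) = lp.single 2 j (1 : ℝ) := by
      rw [← b.repr_symm_single, LinearIsometryEquiv.apply_symm_apply]
    rw [← hU, ← this]
    rfl
  refine ⟨ι, W.toContinuousLinearMap, fun a => ?_⟩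
  have hd : Dense (Submodule.span ℝ (Set.range b) : Set H) :=
    Submodule.dense_iff_topologicalClosure_eq_top.2 b.dense_span
  refine congrFun (Continuous.ext_on hd
    (continuous_integral_exp_mul_I W.toContinuousLinearMap)
    (g := fun a : H => Complex.exp (-(‖a‖ : ℂ) ^ 2 / 2)) (by fun_prop) ?_) a
  intro x hx
  obtain ⟨l, rfl⟩ := (Finsupp.mem_span_range_iff_exists_finsupp).1 hx
  have h1 : (W (l.sum fun i c => c • b i) : (ι → ℝ) → ℝ) =ᵐ[Q]
      fun ω => ∑ j ∈ l.support, l j * ω j := by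
    rw [Finsupp.sum, map_sum]
    have h2 : ∀ᵐ ω ∂Q, ∀ j ∈ l.support, (W (l j • b j) : (ι → ℝ) → ℝ) ω = l j * ω j := by
      refine (ae_ball_iff l.support.countable_toSet).2 fun j _ => ?_
      rw [map_smul, hWb]
      filter_upwards [Lp.coeFn_smul (l j) (ξ j), (memLp_eval_infinitePi_gaussian j).coeFn_toLp]
        with ω h3 h4
      rw [h3, Pi.smul_apply, h4, smul_eq_mul]
    filter_upwards [h2, Lp.coeFn_finsetSum (p := 2) (μ := Q) l.support (fun j => W (l j • b j))]
      with ω h3 h4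
    rw [h4, Finset.sum_apply]
    exact Finset.sum_congr rfl h3
  have h5 : ‖l.sum fun i c => c • b i‖ ^ 2 = ∑ j ∈ l.support, l j ^ 2 := by
    rw [← real_inner_self_eq_norm_sq, Finsupp.sum, b.orthonormal.inner_sum]
    simp [sq]
  have h6 := charFun_infinitePi_gaussian l.support l
  simp only
  rw [← Complex.ofReal_pow, h5, ← h6]
  refine integral_congr_ae ?_
  filter_upwards [h1] with ω hω
  simp only [LinearIsometry.coe_toContinuousLinearMap]
  rw [hω]

end Isonormal

/-! ### Finite-dimensional projections of a random field -/

section FieldProj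

variable {Ω : Type*} [MeasurableSpace Ω] {P : Measure Ω}
  {H : Type*} [NormedAddCommGroup H] [InnerProductSpace ℝ H]

/-- The `E`-valued random vector `∑ⱼ L(uⱼ) uⱼ`, for an orthonormal basis `(uⱼ)` of `E`. -/
def fieldProj (L : H →L[ℝ] Lp ℝ 2 P) (E : Submodule ℝ H) [FiniteDimensional ℝ E] (ω : Ω) : H :=
  ∑ j, (L (stdOrthonormalBasis ℝ E j : H) : Ω → ℝ) ω • (stdOrthonormalBasis ℝ E j : H)

theorem fieldProj_mem (L : H →L[ℝ] Lp ℝ 2 P) (E : Submodule ℝ H) [FiniteDimensional ℝ E] (ω : Ω) :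
    fieldProj L E ω ∈ E :=
  Submodule.sum_mem _ fun j _ => E.smul_mem _ (stdOrthonormalBasis ℝ E j).2

theorem stronglyMeasurable_fieldProj (L : H →L[ℝ] Lp ℝ 2 P) (E : Submodule ℝ H)
    [FiniteDimensional ℝ E] : StronglyMeasurable (fieldProj L E) :=
  Finset.stronglyMeasurable_fun_sum _ fun _ _ => (Lp.stronglyMeasurable _).smul_const _

/-- Self-adjointness of the projection, carried over to the field. The identity is only almost
everywhere because `L` is linear modulo null sets. -/
theorem inner_fieldProj (L : H →L[ℝ] Lp ℝ 2 P) (E : Submodule ℝ H) [FiniteDimensional ℝ E]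
    (v : H) : (fun ω => ⟪v, fieldProj L E ω⟫) =ᵐ[P] L (E.starProjection v) := by
  have h : E.starProjection v =
      ∑ j, ⟪(stdOrthonormalBasis ℝ E j : H), v⟫ • (stdOrthonormalBasis ℝ E j : H) := by
    rw [Submodule.starProjection_apply,
      (stdOrthonormalBasis ℝ E).orthogonalProjectionOnto_apply_eq_sum]
    simp
  rw [h]
  filter_upwards [coeFn_sum_smul L (fun j => ⟪(stdOrthonormalBasis ℝ E j : H), v⟫)
    (fun j => (stdOrthonormalBasis ℝ E j : H))] with ω hω
  rw [hω, fieldProj, inner_sum]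
  refine Finset.sum_congr rfl fun j _ => ?_
  rw [inner_smul_right, real_inner_comm, mul_comm]

/-- The orthonormal bases chosen for the three subspaces are unrelated, so both sides are compared
through their pairings with a basis of `E'`: finitely many null sets suffice. -/
theorem fieldProj_eq_add (L : H →L[ℝ] Lp ℝ 2 P) {E E' : Submodule ℝ H} [FiniteDimensional ℝ E]
    [FiniteDimensional ℝ E'] (h : E ≤ E') :
    fieldProj L E' =ᵐ[P] fun ω => fieldProj L E ω + fieldProj L (E' ⊓ Eᗮ) ω := by
  set D := E' ⊓ Eᗮ
  set b := stdOrthonormalBasis ℝ E'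
  have key : ∀ j, L (E'.starProjection (b j)) =
      L (E.starProjection (b j)) + L (D.starProjection (b j)) := by
    intro j
    rw [← map_add]
    congr 1
    rw [Submodule.starProjection_eq_self_iff.2 (b j).2]
    have : D.starProjection (b j : H) = (b j : H) - E.starProjection (b j : H) := by
      refine (Submodule.eq_starProjection_of_mem_orthogonal ⟨?_, ?_⟩ ?_)
      · exact E'.sub_mem (b j).2 (h (Submodule.starProjection_apply_mem _ _))
      · exact Submodule.sub_starProjection_mem_orthogonal _
      · rw [sub_sub_cancel]
        exact (Submodule.le_orthogonal_iff_le_orthogonal.1 inf_le_right)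
          (Submodule.starProjection_apply_mem _ _)
    rw [this]; abel
  have hj : ∀ᵐ ω ∂P, ∀ j, ⟪(b j : H), fieldProj L E' ω⟫ =
      ⟪(b j : H), fieldProj L E ω + fieldProj L D ω⟫ := by
    rw [ae_all_iff]
    intro j
    have h4 := Lp.coeFn_add (L (E.starProjection (b j : H))) (L (D.starProjection (b j : H)))
    rw [← key] at h4
    filter_upwards [inner_fieldProj L E (b j : H), inner_fieldProj L D (b j : H),
      inner_fieldProj L E' (b j : H), h4] with ω h1 h2 h3 h4
    rw [inner_add_right, h1, h2, h3, h4, Pi.add_apply]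
  filter_upwards [hj] with ω hω
  have := InnerProductSpace.ext_inner_left_basis (𝕜 := ℝ) b.toBasis
    (x := (⟨_, fieldProj_mem L E' ω⟩ : E'))
    (y := ⟨_, E'.add_mem (h (fieldProj_mem L E ω)) (fieldProj_mem L D ω).1⟩)
    (fun j => by simpa using hω j)
  exact congrArg Subtype.val this

theorem IsIsonormal.measure_fieldProj [IsProbabilityMeasure P] [MeasurableSpace H] [BorelSpace H]
    {W : H →L[ℝ] Lp ℝ 2 P} (hW : IsIsonormal W) (E : Submodule ℝ H) [FiniteDimensional ℝ E]
    (h : ℝ≥0) {s : Set H} (hs : MeasurableSet s) :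
    P {ω | Real.sqrt h • fieldProj W E ω ∈ s} = gaussian E h {y : E | (y : H) ∈ s} := by
  set b := stdOrthonormalBasis ℝ E
  have hu : Orthonormal ℝ fun j => (b j : H) :=
    b.orthonormal.comp_linearIsometry E.subtypeₗᵢ
  have hm : Measurable (fun ω k => (W (b k : H) : Ω → ℝ) ω) :=
    measurable_pi_lambda _ fun k => (Lp.stronglyMeasurable (W (b k : H))).measurable
  have hm1 : Measurable fun x : Fin (Module.finrank ℝ E) → ℝ => ∑ i, x i • b i := by fun_prop
  have hm2 : Measurable fun y : E => Real.sqrt h • y := by fun_prop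
  have hs' : MeasurableSet {y : E | (y : H) ∈ s} := measurable_subtype_coe hs
  rw [gaussian, stdGaussian, ← hW.map_eq_pi hu, Measure.map_map hm1 hm,
    Measure.map_map hm2 (hm1.comp hm), Measure.map_apply (hm2.comp (hm1.comp hm)) hs']
  congr 1
  ext ω
  simp [fieldProj, b]

end FieldProj

/-! ### Gross' theorem: existence of the Wiener measure -/

section Gross

variable {H : Type*} [NormedAddCommGroup H] [InnerProductSpace ℝ H]
  {B : Type*} [NormedAddCommGroup B] [NormedSpace ℝ B] {i : H →L[ℝ] B}

/-- The subspaces of Gross' condition may be enlarged, since being orthogonal to more is a stronger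
demand; adjoining a dense sequence and taking partial sums makes them increasing with dense union.
-/
theorem IsAbstractWienerSpace.exists_monotone_subspaces [MeasurableSpace H]
    (hi : IsAbstractWienerSpace i) {h : ℝ≥0}
    (hh : 0 < h) {ε : ℕ → ℝ} (hε : ∀ n, 0 < ε n) :
    ∃ G : ℕ → Submodule ℝ H, (∀ n, FiniteDimensional ℝ (G n)) ∧ Monotone G ∧
      ⊤ ≤ (⨆ n, G n).topologicalClosure ∧
      ∀ n (D : Submodule ℝ H) [FiniteDimensional ℝ D], D ⟂ G n →
        gaussian D h {y : D | ε n < ‖i (y : H)‖} < ENNReal.ofReal (ε n) := by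
  have := hi.separable
  choose F hF hFε using fun n => hi.measurable_norm (ε n) h (hε n) hh
  set S : ℕ → Submodule ℝ H := fun k => F k ⊔ Submodule.span ℝ {TopologicalSpace.denseSeq H k}
  have hle : ∀ n, S n ≤ (Finset.range (n + 1)).sup S := fun n =>
    Finset.le_sup (f := S) (Finset.self_mem_range_succ n)
  refine ⟨fun n => (Finset.range (n + 1)).sup S, fun n => inferInstance, ?_, ?_, ?_⟩
  · intro m n hmn
    exact Finset.sup_mono (Finset.range_mono (by omega))
  · rintro x -
    refine closure_mono ?_ (TopologicalSpace.denseRange_denseSeq H x)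
    rintro _ ⟨k, rfl⟩
    exact (le_iSup (fun n => (Finset.range (n + 1)).sup S) k) (hle k (Submodule.mem_sup_right
      (Submodule.mem_span_singleton_self _)))
  · intro n D _ hD
    exact hFε n D (hD.mono_right (le_sup_left.trans (hle n)))

variable {Ω : Type*} [MeasurableSpace Ω] {P : Measure Ω} [IsProbabilityMeasure P]

/-- The random series defining the Wiener measure converges almost surely. -/
theorem IsIsonormal.exists_tendsto [MeasurableSpace H] [BorelSpace H] [CompleteSpace B]
    [MeasurableSpace B] [BorelSpace B] {W : H →L[ℝ] Lp ℝ 2 P} (hW : IsIsonormal W) (h : ℝ≥0)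
    {G : ℕ → Submodule ℝ H} [∀ n, FiniteDimensional ℝ (G n)] (hG : Monotone G)
    (hGε : ∀ n (D : Submodule ℝ H) [FiniteDimensional ℝ D], D ⟂ G n →
        gaussian D h {y : D | (1 / 2 : ℝ) ^ n < ‖i (y : H)‖} < ENNReal.ofReal ((1 / 2) ^ n)) :
    ∃ X : Ω → B, Measurable X ∧ ∀ᵐ ω ∂P, Tendsto
      (fun n => i (Real.sqrt h • fieldProj W (G n) ω)) atTop (𝓝 (X ω)) := by
  refine measurable_limit_of_tendsto_metrizable_ae (fun n => ?_) ?_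
  · exact (i.continuous.comp_stronglyMeasurable
      ((stronglyMeasurable_fieldProj W (G n)).const_smul _)).measurable.aemeasurable
  -- Bad events for Borel–Cantelli: the increment lives on `G (n + 1) ⊓ (G n)ᗮ`, which is orthogonal
  -- to `G n`, so Gross' condition applies.
  set s : ℕ → Set Ω := fun n =>
    {ω | Real.sqrt h • fieldProj W (G (n + 1) ⊓ (G n)ᗮ) ω ∈ {x : H | (1 / 2 : ℝ) ^ n < ‖i x‖}}
  have hs : ∀ n, P (s n) ≤ ENNReal.ofReal ((1 / 2) ^ n) := by
    intro n
    have hmeas : MeasurableSet {x : H | (1 / 2 : ℝ) ^ n < ‖i x‖} :=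
      (isOpen_lt continuous_const (by fun_prop)).measurableSet
    rw [hW.measure_fieldProj _ h hmeas]
    refine (hGε n _ ?_).le
    exact (Submodule.isOrtho_orthogonal_left (G n)).mono_left inf_le_right
  have hsum : ∑' n, P (s n) ≠ ∞ := by
    refine ne_top_of_le_ne_top ?_ (ENNReal.tsum_le_tsum hs)
    exact (summable_geometric_two).tsum_ofReal_ne_top
  have hadd : ∀ᵐ ω ∂P, ∀ n, fieldProj W (G (n + 1)) ω =
      fieldProj W (G n) ω + fieldProj W (G (n + 1) ⊓ (G n)ᗮ) ω :=
    ae_all_iff.2 fun n => fieldProj_eq_add W (hG n.le_succ)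
  filter_upwards [ae_eventually_notMem hsum, hadd] with ω h1 h2
  refine cauchySeq_tendsto_of_complete (cauchySeq_of_summable_dist ?_)
  refine Summable.of_norm_bounded_eventually_nat summable_geometric_two ?_
  filter_upwards [h1] with n hn
  rw [Real.norm_of_nonneg dist_nonneg, dist_comm, dist_eq_norm, ← map_sub, ← smul_sub, h2 n,
    add_sub_cancel_left]
  exact not_lt.1 hn

/-- The variables `c W(π_{G_n} (riesz i u))` converge in `L²` to the right side and almost surely to
the left side; limits in probability are unique. -/
theorem dual_ae_eq_of_tendsto_fieldProj [CompleteSpace H] (W : H →L[ℝ] Lp ℝ 2 P) (c : ℝ)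
    {G : ℕ → Submodule ℝ H} [∀ n, FiniteDimensional ℝ (G n)] (hG : Monotone G)
    (hG' : ⊤ ≤ (⨆ n, G n).topologicalClosure) {X : Ω → B}
    (hX : ∀ᵐ ω ∂P, Tendsto (fun n => i (c • fieldProj W (G n) ω)) atTop (𝓝 (X ω)))
    (u : StrongDual ℝ B) :
    (fun ω => u (X ω)) =ᵐ[P] fun ω => c * (W (riesz i u) : Ω → ℝ) ω := by
  have h1 : Tendsto (fun n => c • W ((G n).starProjection (riesz i u))) atTop
      (𝓝 (c • W (riesz i u))) :=
    ((W.continuous.tendsto _).comp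
      (Submodule.starProjection_tendsto_self G hG (riesz i u) hG')).const_smul c
  have h2 := tendstoInMeasure_of_tendsto_Lp h1
  have h3 : TendstoInMeasure P
      (fun n => ((c • W ((G n).starProjection (riesz i u)) : Lp ℝ 2 P) : Ω → ℝ)) atTop
      (fun ω => u (X ω)) := by
    refine tendstoInMeasure_of_tendsto_ae (fun n => Lp.aestronglyMeasurable _) ?_
    have h4 : ∀ᵐ ω ∂P, ∀ n, (c • W ((G n).starProjection (riesz i u)) : Lp ℝ 2 P) ω =
        u (i (c • fieldProj W (G n) ω)) := by
      rw [ae_all_iff]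
      intro n
      filter_upwards [Lp.coeFn_smul c (W ((G n).starProjection (riesz i u))),
        inner_fieldProj W (G n) (riesz i u)] with ω h5 h6
      rw [h5, Pi.smul_apply, ← h6, inner_riesz, map_smul, map_smul]
    filter_upwards [h4, hX] with ω h5 h6
    simp only [h5]
    exact (u.continuous.tendsto _).comp h6
  filter_upwards [tendstoInMeasure_ae_unique h3 h2, Lp.coeFn_smul c (W (riesz i u))] with ω h5 h6
  rw [h5, h6, Pi.smul_apply, smul_eq_mul]

theorem IsIsonormal.isWienerMeasure_map [CompleteSpace H] [MeasurableSpace B] [BorelSpace B]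
    {W : H →L[ℝ] Lp ℝ 2 P} (hW : IsIsonormal W) (h : ℝ≥0) {X : Ω → B} (hXm : Measurable X)
    (hX : ∀ u : StrongDual ℝ B,
      (fun ω => u (X ω)) =ᵐ[P] fun ω => Real.sqrt h * (W (riesz i u) : Ω → ℝ) ω) :
    IsWienerMeasure i h (P.map X) := by
  refine ⟨Measure.isProbabilityMeasure_map hXm.aemeasurable, fun n u hu => ?_⟩
  have hm : Measurable (fun ω k => (W (riesz i (u k)) : Ω → ℝ) ω) :=
    measurable_pi_lambda _ fun k => (Lp.stronglyMeasurable _).measurable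
  have hm1 : Measurable fun (x : Fin n → ℝ) k => Real.sqrt h * x k := by fun_prop
  rw [Measure.map_map (by fun_prop) hXm]
  calc P.map ((fun x k => u k x) ∘ X)
      = P.map ((fun (x : Fin n → ℝ) k => Real.sqrt h * x k) ∘
          fun ω k => (W (riesz i (u k)) : Ω → ℝ) ω) := by
        refine Measure.map_congr ?_
        filter_upwards [ae_all_iff.2 fun k => hX (u k)] with ω hω
        exact funext hω
    _ = Measure.pi (fun _ : Fin n => gaussianReal 0 h) := by
        rw [← Measure.map_map hm1 hm, hW.map_eq_pi hu]
        have hg : (gaussianReal 0 1).map (fun x => Real.sqrt h * x) = gaussianReal 0 h := by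
          rw [gaussianReal_map_const_mul]
          congr 1
          · simp
          · ext; simp
        have : ∀ _ : Fin n, SigmaFinite ((gaussianReal 0 1).map (fun x => Real.sqrt h * x)) := by
          rw [hg]; infer_instance
        rw [Measure.pi_map_pi (f := fun _ x => Real.sqrt h * x) (fun _ => by fun_prop), hg]

/-- Gross' theorem: an abstract Wiener space carries Wiener measures of all variances. -/
theorem IsAbstractWienerSpace.exists_isWienerMeasure [CompleteSpace H] [MeasurableSpace H]
    [BorelSpace H] [CompleteSpace B] [MeasurableSpace B] [BorelSpace B]
    (hi : IsAbstractWienerSpace i) {h : ℝ≥0} (hh : 0 < h) :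
    ∃ μ : Measure B, IsWienerMeasure i h μ := by
  obtain ⟨ι, W, hW⟩ := exists_isIsonormal H
  obtain ⟨G, hfin, hG, hG', hGε⟩ := hi.exists_monotone_subspaces hh
    (ε := fun n => (1 / 2) ^ n) (fun n => by positivity)
  obtain ⟨X, hXm, hX⟩ := hW.exists_tendsto h hG hGε
  exact ⟨_, hW.isWienerMeasure_map h hXm
    fun u => dual_ae_eq_of_tendsto_fieldProj W (Real.sqrt h) hG hG' hX u⟩

end Gross

/-! ### The map `ℓ` from `H` to `L²` -/

section Ell

variable {H : Type*} [NormedAddCommGroup H] [InnerProductSpace ℝ H] [CompleteSpace H]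
  {B : Type*} [NormedAddCommGroup B] [NormedSpace ℝ B] {i : H →L[ℝ] B}

/-- If `x` is orthogonal to the range, every functional on `B` vanishes at `i x`; Hahn–Banach and
injectivity of `i` give `x = 0`. -/
theorem denseRange_riesz (hi : Function.Injective i) : DenseRange (riesz i) := by
  have h : (LinearMap.range (riesz i)).topologicalClosure = ⊤ := by
    rw [Submodule.topologicalClosure_eq_top_iff, Submodule.eq_bot_iff]
    intro x hx
    have h1 : ∀ u : StrongDual ℝ B, u (i x) = 0 := fun u => by
      rw [← inner_riesz]
      exact hx _ (LinearMap.mem_range_self _ u)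
    exact hi ((SeparatingDual.eq_zero_of_forall_dual_eq_zero (R := ℝ) h1).trans (map_zero i).symm)
  exact Submodule.dense_iff_topologicalClosure_eq_top.2 h

theorem eq_zero_of_riesz_eq_zero (hi : DenseRange i) {u : StrongDual ℝ B} (hu : riesz i u = 0) :
    u = 0 := by
  have h : (u : B → ℝ) = (0 : StrongDual ℝ B) := by
    refine hi.equalizer u.continuous (0 : StrongDual ℝ B).continuous (funext fun x => ?_)
    simp [← inner_riesz, hu]
  exact DFunLike.coe_injective h

variable [MeasurableSpace B] [BorelSpace B] {μ : Measure B} {h : ℝ≥0}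

/-- The defining property with `n = 1` handles the normalised functional; rescaling does the rest.
In the degenerate case `u = 0`, by density of the range. -/
theorem IsWienerMeasure.map_dual (hμ : IsWienerMeasure i h μ) (hi : DenseRange i)
    (u : StrongDual ℝ B) : μ.map u = gaussianReal 0 (‖riesz i u‖₊ ^ 2 * h) := by
  have := hμ.isProbabilityMeasure
  by_cases hu : riesz i u = 0
  · rw [hu, eq_zero_of_riesz_eq_zero hi hu]
    have : ((0 : StrongDual ℝ B) : B → ℝ) = fun _ => 0 := rfl
    simp [this, Measure.map_const]
  · set c := ‖riesz i u‖
    have hc : c ≠ 0 := norm_ne_zero_iff.2 hu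
    set v := c⁻¹ • u
    have hv : Orthonormal ℝ fun _ : Fin 1 => riesz i v := by
      refine ⟨fun _ => ?_, fun j k hjk => absurd (Subsingleton.elim j k) hjk⟩
      rw [map_smul, norm_smul, norm_inv, norm_norm, inv_mul_cancel₀ hc]
    have h1 := hμ.map_eq 1 (fun _ => v) hv
    have h2 : μ.map v = gaussianReal 0 h := by
      have := congrArg (Measure.map fun x : Fin 1 → ℝ => x 0) h1
      rw [Measure.map_map (by fun_prop) (by fun_prop)] at this
      exact this.trans (measurePreserving_eval (fun _ : Fin 1 => gaussianReal 0 h) 0).map_eq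
    have h3 : (u : B → ℝ) = (fun x => c * x) ∘ v := by
      ext x
      simp [v, hc]
    rw [h3, ← Measure.map_map (by fun_prop) (by fun_prop), h2, gaussianReal_map_const_mul]
    congr 1
    simp

theorem IsWienerMeasure.isGaussian (hμ : IsWienerMeasure i h μ) (hi : DenseRange i) :
    IsGaussian μ :=
  isGaussian_of_map_eq_gaussianReal fun u => ⟨_, _, hμ.map_dual hi u⟩

theorem IsWienerMeasure.norm_toLp [CompleteSpace B] [TopologicalSpace.SeparableSpace H]
    (hμ : IsWienerMeasure i h μ) (hi : DenseRange i) (u : StrongDual ℝ B) :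
    ‖StrongDual.toLp μ 2 u‖ = Real.sqrt h * ‖riesz i u‖ := by
  have := hμ.isGaussian hi
  have : TopologicalSpace.SeparableSpace B := hi.separableSpace i.continuous
  have : SecondCountableTopology B := UniformSpace.secondCountable_of_separable B
  -- Square integrability of the norm under a Gaussian measure (Fernique) is what lets
  -- `StrongDual.toLp` unfold to the actual inclusion. Second countability of `B` comes from
  -- separability of `H`.
  have hLp : MemLp id 2 μ := IsGaussian.memLp_two_id
  have hsq : ‖StrongDual.toLp μ 2 u‖ ^ 2 = h * ‖riesz i u‖ ^ 2 := by
    rw [StrongDual.toLp_apply hLp, ← real_inner_self_eq_norm_sq, L2.inner_def]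
    have h1 : ∫ x, u x ^ 2 ∂μ = ∫ y, y ^ 2 ∂(μ.map u) := by
      rw [integral_map (by fun_prop) (by fun_prop)]
    have h2 : ∫ y, y ^ 2 ∂(μ.map u) = h * ‖riesz i u‖ ^ 2 := by
      rw [hμ.map_dual hi]
      have := variance_fun_id_gaussianReal (μ := 0) (v := ‖riesz i u‖₊ ^ 2 * h)
      rw [variance_eq_integral (by fun_prop)] at this
      simpa [mul_comm] using this
    rw [← h2, ← h1]
    refine integral_congr_ae ?_
    filter_upwards [(hLp.continuousLinearMap_comp u).coeFn_toLp] with x hx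
    change ⟪(MemLp.toLp (fun x => u (id x)) _ : Lp ℝ 2 μ) x,
      (MemLp.toLp (fun x => u (id x)) _ : Lp ℝ 2 μ) x⟫ = _
    rw [hx]
    simp [sq]
  have h3 : ‖StrongDual.toLp μ 2 u‖ ^ 2 = (Real.sqrt h * ‖riesz i u‖) ^ 2 := by
    rw [hsq, mul_pow, Real.sq_sqrt h.coe_nonneg]
  exact (sq_eq_sq₀ (norm_nonneg _) (by positivity)).1 h3

theorem IsWienerMeasure.norm_ell_le [CompleteSpace B] [MeasurableSpace H]
    (hi : IsAbstractWienerSpace i) (hμ : IsWienerMeasure i h μ) (a : H) :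
    ‖ell i μ a‖ ≤ Real.sqrt h * ‖a‖ :=
  have := hi.separable
  LinearMap.norm_extendOfNorm_apply_le (denseRange_riesz hi.injective) _
    (fun u => (hμ.norm_toLp hi.denseRange u).le) a

end Ell

/-! ### Lipschitz pair energies on a weighted graph -/

section PairEnergy

variable {ι S : Type*}

/-- The term `w_e V(a_{s(e)} - a_{t(e)})` attached to the edge `e`, from `s(e)` to `t(e)`. -/
def pairTerm (w : S → ℝ) (s t : S → ι) (V : ℝ → ℝ) (a : ι → ℝ) (e : S) : ℝ :=
  w e * V (a (s e) - a (t e))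

/-- The energy `∑ₑ w_e V(a_{s(e)} - a_{t(e)})`. -/
def pairEnergy (w : S → ℝ) (s t : S → ι) (V : ℝ → ℝ) (a : ι → ℝ) : ℝ :=
  ∑' e, pairTerm w s t V a e

variable {w : S → ℝ} {s t : S → ι} {V : ℝ → ℝ} {K : ℝ≥0}

theorem pairEnergy_nonneg (hw : ∀ e, 0 ≤ w e) (hV : ∀ r, 0 ≤ V r) (a : ι → ℝ) :
    0 ≤ pairEnergy w s t V a :=
  tsum_nonneg fun e => mul_nonneg (hw e) (hV _)

theorem norm_pairTerm_sub_le (hw : ∀ e, 0 ≤ w e) (hV : LipschitzWith K V) (a b : ι → ℝ) (e : S) :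
    ‖pairTerm w s t V a e - pairTerm w s t V b e‖ ≤
      w e * (K * (‖a (s e) - b (s e)‖ + ‖a (t e) - b (t e)‖)) := by
  rw [pairTerm, pairTerm, ← mul_sub, norm_mul, Real.norm_of_nonneg (hw e)]
  refine mul_le_mul_of_nonneg_left ?_ (hw e)
  rw [← dist_eq_norm]
  refine (hV.dist_le_mul _ _).trans (mul_le_mul_of_nonneg_left ?_ K.coe_nonneg)
  rw [dist_eq_norm, sub_sub_sub_comm]
  exact norm_sub_le _ _

theorem summable_pairTerm (hw : ∀ e, 0 ≤ w e) (hws : Summable w) (hV : LipschitzWith K V)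
    {a : ι → ℝ} (ha : Summable fun e => w e * (‖a (s e)‖ + ‖a (t e)‖)) :
    Summable (pairTerm w s t V a) := by
  refine Summable.of_norm_bounded ((hws.mul_right ‖V 0‖).add (ha.mul_left (K : ℝ))) fun e => ?_
  have h1 := norm_pairTerm_sub_le (s := s) (t := t) hw hV a 0 e
  have h2 : ‖pairTerm w s t V 0 e‖ = w e * ‖V 0‖ := by
    simp [pairTerm, abs_of_nonneg (hw e)]
  have h3 := norm_le_norm_add_norm_sub' (pairTerm w s t V a e) (pairTerm w s t V 0 e)
  simp only [Pi.zero_apply, sub_zero] at h1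
  linarith

theorem summable_pairTerm_of_bounded (hw : ∀ e, 0 ≤ w e) (hws : Summable w)
    (hV : LipschitzWith K V) {a : ι → ℝ} {M : ℝ} (ha : ∀ j, ‖a j‖ ≤ M) :
    Summable (pairTerm w s t V a) :=
  summable_pairTerm hw hws hV <| Summable.of_nonneg_of_le
    (fun e => mul_nonneg (hw e) (by positivity))
    (fun e => mul_le_mul_of_nonneg_left (add_le_add (ha _) (ha _)) (hw e)) (hws.mul_right (M + M))

/-- Both summability hypotheses matter, a divergent `tsum` being `0`. The bound takes values in `[0,
∞]` so that it can be integrated term by term. -/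
theorem enorm_pairEnergy_sub_le (hw : ∀ e, 0 ≤ w e) (hV : LipschitzWith K V) {a b : ι → ℝ}
    (ha : Summable (pairTerm w s t V a)) (hb : Summable (pairTerm w s t V b)) :
    ‖pairEnergy w s t V a - pairEnergy w s t V b‖ₑ ≤
      ∑' e, ENNReal.ofReal (w e * K) * (‖a (s e) - b (s e)‖ₑ + ‖a (t e) - b (t e)‖ₑ) := by
  rw [pairEnergy, pairEnergy, ← ha.tsum_sub hb]
  refine enorm_tsum_le_tsum_enorm.trans (ENNReal.tsum_le_tsum fun e => ?_)
  rw [← ofReal_norm, ← ofReal_norm, ← ofReal_norm,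
    ← ENNReal.ofReal_add (norm_nonneg _) (norm_nonneg _),
    ← ENNReal.ofReal_mul (mul_nonneg (hw e) K.coe_nonneg), mul_assoc]
  exact ENNReal.ofReal_le_ofReal (norm_pairTerm_sub_le hw hV a b e)

variable {Ω : Type*} [MeasurableSpace Ω] {P : Measure Ω}

theorem measurable_pairEnergy [Countable S] (hV : Continuous V) {X : ι → Ω → ℝ}
    (hX : ∀ j, Measurable (X j)) : Measurable fun ω => pairEnergy w s t V fun j => X j ω :=
  Measurable.tsum fun e => measurable_const.mul
    (hV.measurable.comp ((hX (s e)).sub (hX (t e))))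

theorem lintegral_enorm_le_norm [IsProbabilityMeasure P] (f : Lp ℝ 2 P) :
    ∫⁻ ω, ‖(f : Ω → ℝ) ω‖ₑ ∂P ≤ ENNReal.ofReal ‖f‖ := by
  rw [Lp.norm_def, ENNReal.ofReal_toReal (Lp.eLpNorm_ne_top f), ← eLpNorm_one_eq_lintegral_enorm]
  exact eLpNorm_le_eLpNorm_of_exponent_le (by norm_num) (Lp.aestronglyMeasurable f)

theorem lintegral_tsum_le_ofReal [Countable S] [IsProbabilityMeasure P] {c : S → ℝ}
    (hc : ∀ e, 0 ≤ c e) (X : ι → Lp ℝ 2 P) :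
    ∫⁻ ω, ∑' e, ENNReal.ofReal (c e) * (‖(X (s e) : Ω → ℝ) ω‖ₑ + ‖(X (t e) : Ω → ℝ) ω‖ₑ) ∂P ≤
      ∑' e, ENNReal.ofReal (c e * (‖X (s e)‖ + ‖X (t e)‖)) := by
  have hm : ∀ j, Measurable fun ω => ‖(X j : Ω → ℝ) ω‖ₑ := fun j =>
    (Lp.stronglyMeasurable (X j)).measurable.enorm
  have hm2 : ∀ e, Measurable fun ω => ‖(X (s e) : Ω → ℝ) ω‖ₑ + ‖(X (t e) : Ω → ℝ) ω‖ₑ :=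
    fun e => (hm _).add (hm _)
  rw [lintegral_tsum fun e => ((hm2 e).const_mul _).aemeasurable]
  refine ENNReal.tsum_le_tsum fun e => ?_
  rw [lintegral_const_mul _ (hm2 e), lintegral_add_left (hm _),
    ENNReal.ofReal_mul (hc e), ENNReal.ofReal_add (norm_nonneg _) (norm_nonneg _)]
  gcongr <;> exact lintegral_enorm_le_norm _

/-- The coordinates are bounded in `L²`, not pointwise in `j`; by Tonelli the weighted sum of their
absolute values has finite expectation, so it is finite almost surely. -/
theorem ae_summable_pairTerm [Countable S] [IsProbabilityMeasure P] (hw : ∀ e, 0 ≤ w e)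
    (hws : Summable w) (hV : LipschitzWith K V) {X : ι → Lp ℝ 2 P} {M : ℝ} (hX : ∀ j, ‖X j‖ ≤ M) :
    ∀ᵐ ω ∂P, Summable (pairTerm w s t V fun j => (X j : Ω → ℝ) ω) := by
  have hm : ∀ j, Measurable fun ω => ‖(X j : Ω → ℝ) ω‖ₑ := fun j =>
    (Lp.stronglyMeasurable (X j)).measurable.enorm
  have hm2 : ∀ e, Measurable fun ω => ‖(X (s e) : Ω → ℝ) ω‖ₑ + ‖(X (t e) : Ω → ℝ) ω‖ₑ :=
    fun e => (hm _).add (hm _)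
  have hfin : ∫⁻ ω, ∑' e, ENNReal.ofReal (w e) *
      (‖(X (s e) : Ω → ℝ) ω‖ₑ + ‖(X (t e) : Ω → ℝ) ω‖ₑ) ∂P ≠ ∞ := by
    refine ne_top_of_le_ne_top ?_ (lintegral_tsum_le_ofReal hw X)
    refine Summable.tsum_ofReal_ne_top (Summable.of_nonneg_of_le
      (fun e => mul_nonneg (hw e) (by positivity))
      (fun e => mul_le_mul_of_nonneg_left (add_le_add (hX _) (hX _)) (hw e))
      (hws.mul_right (M + M)))
  filter_upwards [ae_lt_top (Measurable.tsum fun e => (hm2 e).const_mul _) hfin]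
    with ω hω
  refine summable_pairTerm hw hws hV ((ENNReal.summable_toReal hω.ne).congr fun e => ?_)
  rw [ENNReal.toReal_mul, ENNReal.toReal_ofReal (hw e), ENNReal.toReal_add enorm_ne_top enorm_ne_top,
    toReal_enorm, toReal_enorm]

theorem lintegral_enorm_pairEnergy_sub_le [Countable S] [IsProbabilityMeasure P]
    (hw : ∀ e, 0 ≤ w e) (hws : Summable w) (hV : LipschitzWith K V) {X Y : ι → Lp ℝ 2 P} {M : ℝ}
    (hX : ∀ j, ‖X j‖ ≤ M) (hY : ∀ j, ‖Y j‖ ≤ M) [Countable ι] :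
    ∫⁻ ω, ‖(pairEnergy w s t V fun j => (X j : Ω → ℝ) ω) -
        pairEnergy w s t V fun j => (Y j : Ω → ℝ) ω‖ₑ ∂P ≤
      ∑' e, ENNReal.ofReal (w e * K * (‖X (s e) - Y (s e)‖ + ‖X (t e) - Y (t e)‖)) := by
  refine le_trans (lintegral_mono_ae ?_)
    (lintegral_tsum_le_ofReal (fun e => mul_nonneg (hw e) K.coe_nonneg) fun j => X j - Y j)
  filter_upwards [ae_summable_pairTerm hw hws hV hX, ae_summable_pairTerm hw hws hV hY,
    ae_all_iff.2 fun j => Lp.coeFn_sub (X j) (Y j)] with ω h1 h2 h3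
  simp only [h3, Pi.sub_apply]
  exact enorm_pairEnergy_sub_le hw hV h1 h2

/-- Compare with the zero field, whose energy is almost everywhere constant. -/
theorem memLp_pairEnergy [Countable S] [IsProbabilityMeasure P]
    (hw : ∀ e, 0 ≤ w e) (hws : Summable w) (hV : LipschitzWith K V) {X : ι → Lp ℝ 2 P} {M : ℝ}
    (hX : ∀ j, ‖X j‖ ≤ M) [Countable ι] :
    MemLp (fun ω => pairEnergy w s t V fun j => (X j : Ω → ℝ) ω) 1 P := by
  have hM : ∀ j : ι, ‖(0 : Lp ℝ 2 P)‖ ≤ M := fun j => by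
    rw [norm_zero]; exact (norm_nonneg _).trans (hX j)
  have h1 : MemLp (fun ω => (pairEnergy w s t V fun j => (X j : Ω → ℝ) ω) -
      pairEnergy w s t V fun _ => ((0 : Lp ℝ 2 P) : Ω → ℝ) ω) 1 P := by
    have hm : ∀ X : ι → Lp ℝ 2 P,
        Measurable fun ω => pairEnergy w s t V fun j => (X j : Ω → ℝ) ω := fun X =>
      measurable_pairEnergy hV.continuous fun j => (Lp.stronglyMeasurable (X j)).measurable
    refine ⟨((hm X).sub (hm fun _ => 0)).aestronglyMeasurable, ?_⟩
    rw [eLpNorm_one_eq_lintegral_enorm]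
    refine (lintegral_enorm_pairEnergy_sub_le hw hws hV hX hM).trans_lt (lt_top_iff_ne_top.2 ?_)
    refine Summable.tsum_ofReal_ne_top (Summable.of_nonneg_of_le
      (fun e => mul_nonneg (mul_nonneg (hw e) K.coe_nonneg) (by positivity)) (fun e =>
        mul_le_mul_of_nonneg_left ?_ (mul_nonneg (hw e) K.coe_nonneg))
      ((hws.mul_right (K : ℝ)).mul_right (M + M)))
    simpa using add_le_add (hX (s e)) (hX (t e))
  have h2 : MemLp (fun ω => pairEnergy w s t V fun _ => ((0 : Lp ℝ 2 P) : Ω → ℝ) ω) 1 P := by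
    refine (memLp_const (pairEnergy w s t V fun _ => 0)).ae_eq ?_
    filter_upwards [Lp.coeFn_zero ℝ 2 P] with ω hω
    rw [hω]; rfl
  convert h1.add h2 using 1
  ext ω
  simp

/-- Convergence need not be uniform in `j`: the uniform `L²` bound and the summable weights dominate
the sum over edges. -/
theorem tendsto_eLpNorm_pairEnergy [Countable S] [IsProbabilityMeasure P]
    (hw : ∀ e, 0 ≤ w e) (hws : Summable w) (hV : LipschitzWith K V) {X : ℕ → ι → Lp ℝ 2 P}
    {Y : ι → Lp ℝ 2 P} {M : ℝ} (hX : ∀ n j, ‖X n j‖ ≤ M) (hY : ∀ j, ‖Y j‖ ≤ M)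
    (hXY : ∀ j, Tendsto (fun n => X n j) atTop (𝓝 (Y j))) [Countable ι] :
    Tendsto (fun n => eLpNorm (fun ω => (pairEnergy w s t V fun j => (X n j : Ω → ℝ) ω) -
        pairEnergy w s t V fun j => (Y j : Ω → ℝ) ω) 1 P) atTop (𝓝 0) := by
  have hd : ∀ n j, ‖X n j - Y j‖ ≤ M + M := fun n j =>
    (norm_sub_le _ _).trans (add_le_add (hX n j) (hY j))
  have hbd : Summable fun e => w e * K * ((M + M) + (M + M)) :=
    (hws.mul_right (K : ℝ)).mul_right _
  have hnn : ∀ n e, 0 ≤ w e * K * (‖X n (s e) - Y (s e)‖ + ‖X n (t e) - Y (t e)‖) := fun n e =>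
    mul_nonneg (mul_nonneg (hw e) K.coe_nonneg) (by positivity)
  have hle : ∀ n e, w e * K * (‖X n (s e) - Y (s e)‖ + ‖X n (t e) - Y (t e)‖) ≤
      w e * K * ((M + M) + (M + M)) := fun n e =>
    mul_le_mul_of_nonneg_left (add_le_add (hd _ _) (hd _ _)) (mul_nonneg (hw e) K.coe_nonneg)
  have h0 : ∀ j, Tendsto (fun n => ‖X n j - Y j‖) atTop (𝓝 0) := fun j =>
    tendsto_iff_norm_sub_tendsto_zero.1 (hXY j)
  have h1 : Tendsto (fun n => ∑' e, w e * K * (‖X n (s e) - Y (s e)‖ + ‖X n (t e) - Y (t e)‖))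
      atTop (𝓝 (∑' e, w e * K * (0 + 0))) := by
    refine tendsto_tsum_of_dominated_convergence hbd
      (fun e => ((h0 _).add (h0 _)).const_mul _) (Eventually.of_forall fun n e => ?_)
    rw [Real.norm_of_nonneg (hnn n e)]
    exact hle n e
  have h2 := ENNReal.tendsto_ofReal h1
  simp only [add_zero, mul_zero, tsum_zero, ENNReal.ofReal_zero] at h2
  refine tendsto_of_tendsto_of_tendsto_of_le_of_le tendsto_const_nhds h2 (fun _ => zero_le) ?_
  intro n
  simp only
  rw [eLpNorm_one_eq_lintegral_enorm, ENNReal.ofReal_tsum_of_nonneg (hnn n)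
    (Summable.of_nonneg_of_le (hnn n) (hle n) hbd)]
  exact lintegral_enorm_pairEnergy_sub_le hw hws hV (hX n) hY

end PairEnergy

/-! ### From `L¹` extensions to extensions of exponentials -/

section StochasticExtension

variable {H : Type*} [NormedAddCommGroup H] [InnerProductSpace ℝ H] [CompleteSpace H]
  [MeasurableSpace H] {B : Type*} [NormedAddCommGroup B] [NormedSpace ℝ B] [MeasurableSpace B]
  [BorelSpace B] {i : H →L[ℝ] B} {μ : Measure B}

/-- If `f ≥ 0` has the stochastic extension `f' ≥ 0` in the sense of `L¹`, then `exp (-t f)` has the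
stochastic extension `exp (-t f')`. -/
theorem IsLpStochasticExtension.exp_neg_mul {f : H → ℝ} {f' : B → ℝ}
    (hf : IsLpStochasticExtension 1 i μ f f') (hm : Measurable f') (h0 : ∀ x, 0 ≤ f x)
    (h0' : ∀ x, 0 ≤ f' x) {t : ℝ} (ht : 0 ≤ t) :
    IsStochasticExtension i μ (fun x => Real.exp (-t * f x)) (fun x => Real.exp (-t * f' x)) where
  measurable := (hf.measurable.const_mul _).exp
  measurable_ext := (hm.const_mul _).exp
  tendsto E _ hE hd := by
    obtain ⟨h1, h2⟩ := hf.tendsto E hE hd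
    have hLip : ∀ a b : ℝ, 0 ≤ a → 0 ≤ b →
        ‖Real.exp (-t * a) - Real.exp (-t * b)‖ ≤ t * ‖a - b‖ := by
      -- For `a ≤ b` the difference is `e^{-ta} (1 - e^{-t(b-a)})`, with `e^{-ta} ≤ 1` and `1 -
      -- e^{-s} ≤ s`.
      have key : ∀ a b : ℝ, 0 ≤ a → a ≤ b →
          ‖Real.exp (-t * a) - Real.exp (-t * b)‖ ≤ t * ‖a - b‖ := by
        intro a b ha hab
        have h3 : Real.exp (-t * b) ≤ Real.exp (-t * a) := Real.exp_le_exp.2 (by nlinarith)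
        have h4 : Real.exp (-t * a) ≤ 1 := Real.exp_le_one_iff.2 (by nlinarith)
        have h5 := Real.add_one_le_exp (-t * (b - a))
        have h6 : Real.exp (-t * b) = Real.exp (-t * a) * Real.exp (-t * (b - a)) := by
          rw [← Real.exp_add]; ring_nf
        rw [Real.norm_of_nonneg (sub_nonneg.2 h3), Real.norm_of_nonpos (sub_nonpos.2 hab), h6]
        have h7 := Real.exp_pos (-t * a)
        have h8 : 0 ≤ t * (b - a) := mul_nonneg ht (sub_nonneg.2 hab)
        nlinarith
      intro a b ha hb
      rcases le_total a b with hab | hab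
      · exact key a b ha hab
      · rw [norm_sub_rev, norm_sub_rev a]
        exact key b a hb hab
    refine tendstoInMeasure_of_tendsto_eLpNorm one_ne_zero (fun n => ?_)
      (hm.const_mul _).exp.aestronglyMeasurable ?_
    · exact (Real.continuous_exp.comp (continuous_const.mul continuous_id)).comp_aestronglyMeasurable
        (h1 n).1
    · have h3 : Tendsto (fun n => ‖t‖ₑ * eLpNorm (f ∘ proj i μ (E n) - f') 1 μ) atTop (𝓝 0) := by
        simpa using ENNReal.Tendsto.const_mul h2 (Or.inr (enorm_ne_top (x := t)))
      refine tendsto_of_tendsto_of_tendsto_of_le_of_le tendsto_const_nhds h3 (fun _ => zero_le) ?_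
      intro n
      simp only
      rw [← eLpNorm_const_smul]
      refine eLpNorm_mono fun x => (hLip _ _ (h0 _) (h0' _)).trans_eq ?_
      simp [abs_of_nonneg ht]

end StochasticExtension

/-! ### The lattice interaction -/

section Lattice

variable {d : ℕ} {q : ℝ≥0∞} {g : (Fin d → ℤ) → ℝ}

/-- The product weight of a pair of neighbours. -/
def neighbourWeight (q : ℝ≥0∞) (g : (Fin d → ℤ) → ℝ) (jk : Neighbours d q) : ℝ :=
  g jk.1.1 * g jk.1.2

theorem interaction_eq_pairEnergy (V : ℝ → ℝ) (x : LatticeL2 d) :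
    interaction q g V x = pairEnergy (neighbourWeight q g) (fun jk : Neighbours d q => jk.1.1)
      (fun jk => jk.1.2) V x := rfl

theorem mem_Icc_of_latticeNorm_eq_one (hq : 1 ≤ q) {m : Fin d → ℤ} (hm : latticeNorm q m = 1) :
    m ∈ Set.Icc (fun _ => -1) (fun _ => 1) := by
  have : Fact (1 ≤ q) := ⟨hq⟩
  have h : ∀ k, |m k| ≤ 1 := fun k => by
    have h1 := PiLp.norm_apply_le (WithLp.toLp q fun k => (m k : ℝ)) k
    rw [show ‖WithLp.toLp q fun k => (m k : ℝ)‖ = 1 from hm, Real.norm_eq_abs] at h1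
    change |(m k : ℝ)| ≤ 1 at h1
    exact_mod_cast h1
  exact ⟨fun k => (abs_le.1 (h k)).1, fun k => (abs_le.1 (h k)).2⟩

/-- Each coordinate of `j - k` lies in `{-1, 0, 1}`, so `(j, k) ↦ (j, j - k)` embeds the pairs into
`ℤ^d` times a finite set. -/
theorem summable_sq_fst (hq : 1 ≤ q) (hg : Summable fun j => g j ^ 2) :
    Summable fun jk : Neighbours d q => g jk.1.1 ^ 2 := by
  set I : Set (Fin d → ℤ) := Set.Icc (fun _ => -1) (fun _ => 1)
  have : Finite I := Set.finite_Icc _ _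
  have h := hg.mul_of_nonneg (g := fun _ : I => (1 : ℝ)) Summable.of_finite
    (fun j => sq_nonneg (g j)) (fun _ => zero_le_one)
  set φ : Neighbours d q → (Fin d → ℤ) × I := fun jk =>
    (jk.1.1, ⟨jk.1.1 - jk.1.2, mem_Icc_of_latticeNorm_eq_one hq jk.2⟩)
  have hφ : Function.Injective φ := by
    rintro ⟨⟨j, k⟩, h1⟩ ⟨⟨j', k'⟩, h2⟩ hh
    simp only [φ, Prod.mk.injEq, Subtype.mk.injEq] at hh
    obtain ⟨rfl, h3⟩ := hh
    simpa using h3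
  refine (h.comp_injective hφ).congr fun jk => ?_
  simp [φ]

theorem latticeNorm_sub_comm (hq : 1 ≤ q) (j k : Fin d → ℤ) :
    latticeNorm q (j - k) = latticeNorm q (k - j) := by
  have : Fact (1 ≤ q) := ⟨hq⟩
  have h : WithLp.toLp q (fun m => ((j - k) m : ℝ)) =
      -WithLp.toLp q (fun m => ((k - j) m : ℝ)) := by
    ext m
    simp
  rw [latticeNorm, h]
  exact norm_neg _

theorem summable_neighbourWeight (hq : 1 ≤ q) (hg_pos : ∀ j, 0 < g j)
    (hg : Summable fun j => g j ^ 2) : Summable (neighbourWeight q g) := by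
  have h1 := summable_sq_fst hq hg
  -- Swapping the two sites turns summability of `g_j²` over pairs into that of `g_k²`; then `g_j
  -- g_k ≤ g_j² + g_k²`.
  set σ : Neighbours d q → Neighbours d q := fun jk =>
    ⟨(jk.1.2, jk.1.1), (latticeNorm_sub_comm hq _ _).trans jk.2⟩
  have hσ : Function.Injective σ := by
    rintro ⟨⟨j, k⟩, h1⟩ ⟨⟨j', k'⟩, h2⟩ hh
    simp only [σ, Prod.mk.injEq, Subtype.mk.injEq] at hh
    simp [hh]
  refine Summable.of_nonneg_of_le (fun jk => (mul_pos (hg_pos _) (hg_pos _)).le) (fun jk => ?_)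
    (h1.add (h1.comp_injective hσ))
  simp only [neighbourWeight, σ, Function.comp_apply]
  nlinarith [sq_nonneg (g jk.1.1 - g jk.1.2), sq_nonneg (g jk.1.1), sq_nonneg (g jk.1.2)]

/-- The unit vector of `ℓ²(ℤ^d)` at the site `j`. -/
def siteVector (j : Fin d → ℤ) : LatticeL2 d := lp.single 2 j 1

theorem norm_siteVector (j : Fin d → ℤ) : ‖siteVector j‖ = 1 := by
  simp [siteVector, lp.norm_single]

theorem inner_siteVector (j : Fin d → ℤ) (x : LatticeL2 d) : ⟪siteVector j, x⟫ = x j := by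
  simp [siteVector, lp.inner_single_left]

variable {B : Type*} [NormedAddCommGroup B] [NormedSpace ℝ B] [MeasurableSpace B] [BorelSpace B]
  {i : LatticeL2 d →L[ℝ] B} {h : ℝ≥0} {μ : Measure B} {V : ℝ → ℝ} {K : ℝ≥0}

theorem measurable_interaction [MeasurableSpace (LatticeL2 d)] [BorelSpace (LatticeL2 d)]
    (hV : Continuous V) :
    Measurable (interaction q g V : LatticeL2 d → ℝ) := by
  simp only [funext (interaction_eq_pairEnergy V)]
  refine measurable_pairEnergy (X := fun j (x : LatticeL2 d) => x j) hV fun j => ?_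
  simp only [← inner_siteVector]
  fun_prop

/-- The stochastic extension of the interaction. -/
def interactionExt (q : ℝ≥0∞) (g : (Fin d → ℤ) → ℝ) (V : ℝ → ℝ) (i : LatticeL2 d →L[ℝ] B)
    (μ : Measure B) (x : B) : ℝ :=
  pairEnergy (neighbourWeight q g) (fun jk : Neighbours d q => jk.1.1) (fun jk => jk.1.2) V
    fun j => (ell i μ (siteVector j) : B → ℝ) x

theorem measurable_interactionExt (hV : Continuous V) : Measurable (interactionExt q g V i μ) :=
  measurable_pairEnergy hV fun _ => (Lp.stronglyMeasurable _).measurable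

/-- `proj i μ` is by definition `fieldProj (ell i μ)`, so one null set per site, countably many in
all, rewrites its coordinates. -/
theorem interaction_comp_proj_ae_eq (V : ℝ → ℝ) (E : Submodule ℝ (LatticeL2 d))
    [FiniteDimensional ℝ E] :
    interaction q g V ∘ proj i μ E =ᵐ[μ] fun x =>
      pairEnergy (neighbourWeight q g) (fun jk : Neighbours d q => jk.1.1) (fun jk => jk.1.2) V
        fun j => (ell i μ (E.starProjection (siteVector j)) : B → ℝ) x := by
  filter_upwards [ae_all_iff.2 fun j => inner_fieldProj (ell i μ) E (siteVector j)] with x hx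
  rw [Function.comp_apply, interaction_eq_pairEnergy]
  congr 1
  ext j
  rw [← hx j, inner_siteVector]
  rfl

theorem isLpStochasticExtension_interaction [MeasurableSpace (LatticeL2 d)]
    [BorelSpace (LatticeL2 d)] [CompleteSpace B] (hq : 1 ≤ q) (hi : IsAbstractWienerSpace i)
    (hV : LipschitzWith K V) (hg_pos : ∀ j, 0 < g j) (hg : Summable fun j => g j ^ 2)
    (hμ : IsWienerMeasure i h μ) :
    IsLpStochasticExtension 1 i μ (interaction q g V) (interactionExt q g V i μ) := by
  have := hμ.isProbabilityMeasure
  have hw : ∀ jk : Neighbours d q, 0 ≤ neighbourWeight q g jk := fun jk =>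
    (mul_pos (hg_pos _) (hg_pos _)).le
  have hws := summable_neighbourWeight hq hg_pos hg
  have hY : ∀ j : Fin d → ℤ, ‖ell i μ (siteVector j)‖ ≤ Real.sqrt h := fun j => by
    simpa [norm_siteVector] using hμ.norm_ell_le hi (siteVector j)
  have hX : ∀ (E : Submodule ℝ (LatticeL2 d)) [FiniteDimensional ℝ E] (j : Fin d → ℤ),
      ‖ell i μ (E.starProjection (siteVector j))‖ ≤ Real.sqrt h := fun E _ j =>
    (hμ.norm_ell_le hi _).trans (mul_le_of_le_one_right (Real.sqrt_nonneg _)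
      ((E.norm_starProjection_apply_le _).trans_eq (norm_siteVector j)))
  refine ⟨measurable_interaction hV.continuous, memLp_pairEnergy hw hws hV hY, ?_⟩
  intro E _ hE hd
  refine ⟨fun n => (memLp_pairEnergy hw hws hV (hX (E n))).ae_eq
    (interaction_comp_proj_ae_eq V (E n)).symm, ?_⟩
  have hd' : ⊤ ≤ (⨆ n, E n).topologicalClosure := by
    rintro x -
    refine closure_mono ?_ (hd x)
    exact Set.iUnion_subset fun n => SetLike.coe_subset_coe.2 (le_iSup E n)
  refine (tendsto_eLpNorm_pairEnergy (s := fun jk : Neighbours d q => jk.1.1)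
    (t := fun jk => jk.1.2) hw hws hV (fun n => hX (E n)) hY fun j =>
    ((ell i μ).continuous.tendsto _).comp
      (Submodule.starProjection_tendsto_self E hE (siteVector j) hd')).congr fun n => ?_
  refine eLpNorm_congr_ae ?_
  filter_upwards [interaction_comp_proj_ae_eq (q := q) (g := g) (i := i) (μ := μ) V (E n)]
    with x hx
  rw [Pi.sub_apply, hx]
  rfl

end Lattice

end Wiener

end

theorem proposition8p8 {d : ℕ} (q : ℝ≥0∞) (hq : 1 ≤ q)
    [MeasurableSpace (Wiener.LatticeL2 d)] [BorelSpace (Wiener.LatticeL2 d)]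
    {B : Type*} [NormedAddCommGroup B] [NormedSpace ℝ B] [CompleteSpace B]
    [MeasurableSpace B] [BorelSpace B]
    (i : Wiener.LatticeL2 d →L[ℝ] B) (hi : Wiener.IsAbstractWienerSpace i)
    (V : ℝ → ℝ) (hV_nonneg : ∀ s, 0 ≤ V s) (K : ℝ≥0) (hV : LipschitzWith K V)
    (g : (Fin d → ℤ) → ℝ) (hg_pos : ∀ j, 0 < g j) (hg : Summable fun j => g j ^ 2)
    (C : ℝ) (hC : ∀ j k : Fin d → ℤ, Wiener.latticeNorm q (j - k) ≤ 1 → g j / g k ≤ C) :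
    (∀ x : Wiener.LatticeL2 d, Summable (Wiener.interactionTerm q g V x)) ∧
    ∀ h : ℝ≥0, 0 < h →
      (∃ μ : Measure B, Wiener.IsWienerMeasure i h μ) ∧
      ∀ μ : Measure B, Wiener.IsWienerMeasure i h μ →
        (∃ P : B → ℝ,
          Wiener.IsLpStochasticExtension 1 i μ (Wiener.interaction q g V) P) ∧
        ∀ t : ℝ, 0 < t → ∃ A : B → ℝ,
          Wiener.IsStochasticExtension i μ
            (fun x => Real.exp (-t * Wiener.interaction q g V x)) A := by
  have hw : ∀ jk : Wiener.Neighbours d q, 0 ≤ Wiener.neighbourWeight q g jk := fun jk =>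
    (mul_pos (hg_pos _) (hg_pos _)).le
  refine ⟨fun x => ?_, fun h hh => ⟨hi.exists_isWienerMeasure hh, fun μ hμ => ?_⟩⟩
  · exact Wiener.summable_pairTerm_of_bounded (s := fun jk : Wiener.Neighbours d q => jk.1.1)
      (t := fun jk => jk.1.2) hw (Wiener.summable_neighbourWeight hq hg_pos hg) hV
      (lp.norm_apply_le_norm two_ne_zero x)
  · have hP := Wiener.isLpStochasticExtension_interaction hq hi hV hg_pos hg hμ
    exact ⟨⟨_, hP⟩, fun t ht => ⟨_, hP.exp_neg_mul
      (Wiener.measurable_interactionExt hV.continuous)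
      (Wiener.pairEnergy_nonneg hw hV_nonneg ·) (fun x => Wiener.pairEnergy_nonneg hw hV_nonneg _)
      ht.le⟩⟩
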